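/- **Model.** Let $\mathcal X\subseteq\mathbb R^k$ ($k\ge1$), let $\lambda\in(0,1]$, and let $\mathcal G$ be a linear space of functions $\mathbb R^p\to\mathbb R$. A *structure* $(\lambda,g_1,g_2,P_1,P_2)$ consists of measurable $g_j\in\mathcal G$ and, for $j=1,2$, a conditional distribution $P_j(\cdot\mid x)$ of $(w,\eta_j)\in\mathbb R^p\times\mathbb R$ given $x$, such that for all $x\in\mathcal X$ the mean $E[\eta_j\mid x]$ exists and is $0$. Put $y=g_j(w)+\eta_j$ and $z=(w,y)\in\mathbb R^{p+1}$ (so $y$ is the $(p+1)$-th coordinate), let $F_j(\cdot\mid x)$ be the law of $z$ given $x$ in component $j$, assumed integrable for $x\in\mathcal X$, and let $F(\cdot\mid x)=\lambda F_1(\cdot\mid x)+(1-\lambda)F_2(\cdot\mid x)$ be the observable conditional law of $z$. Let $m_j(x)=\int z\,dF_j(z\mid x)$, $D=m_2-m_1$, $\epsilon_j=z-m_j(x)$, and $T_j[f](x)=\int f(w)\,dF_j(w\mid x)$ for $x\in\mathcal X$. The structure has *independent errors* if, for $j=1,2$, the law $F_j^\epsilon$ of $\epsilon_j$ given $x$ is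 the same for all $x\in\mathcal X$. If $\lambda=1$ there is only one component and component 2 is immaterial. For $x_0\in\mathbb R^k$, $\delta>0$ let $N^1(x_0,\delta)$ be the set of points that agree with $x_0$ except in the first coordinate, which differs from that of $x_0$ by less than $\delta$. Let $M_j(t)=\int e^{t^\top\epsilon}dF_j^\epsilon(\epsilon)$, $M(t\mid x)=\int e^{t^\top z}dF(z\mid x)$, $R(t,x)=M(t\mid x)/M(t\mid x_0)$ for $t\in\mathbb R^{p+1}$, let $e_i$ be the $i$-th unit vector, and for $i\le p+1$ let $$h_i(c,t)=e^{tD_i(x_0)(1-c)}\,\frac{M_2(te_i)}{M_1(te_i)}.$$ * **Assumption E** (at $x_0$, for $\delta>0$): $N^1(x_0,\delta)\subseteq\mathcal X$; errors are independent; if $\lambda<1$, then $m_{1}(x_0)_i-m_{1}(x)_i\ne m_{2}(x_0)_i-m_{2}(x)_i$ for all $i\le p+1$ and all $x\in N^1(x_0,\delta)\setminus\{x_0\}$; $m_1,m_2$ (on $\mathcal X$) are continuous at $x_0$. * **Assumption F**: $M_1,M_2$ are finite on $\mathbb R^{p+1}$; for some $\varepsilon>0$ and each $i\le p+1$, either $h_i(\pm\varepsilon,t)=O(1)$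 or $1/h_i(\pm\varepsilon,t)=O(1)$ as $t\to+\infty$, and likewise as $t\to-\infty$. * **Condition IV**: either (i) for each $i\le p$ there is $x\in N^1(x_0,\delta)$ such that $L^{\pm}_i(x)=\lim_{t\to\pm\infty}\frac1t\log R(te_i,x)$ exist and $L_i^+(x)\neq L_i^-(x)$; or (ii) for each $i\le p$ there is $x\in N^1(x_0,\delta)$ such that these limits exist and $$\lim_{c\downarrow0}\frac{E[z_i\mid x]-E[z_i\mid x_0]-(1+c)L_i^-(x)}{L_i^+(x)-(1+c)L_i^-(x)}=1.$$ * **Invertibility**: for $j=1,2$, $T_j$ is one-to-one on the functions in $\mathcal G$ that are integrable under $F_j(w\mid x)$ for every $x\in\mathcal X$, functions being identified if they agree $F_j(w\mid x)$-a.s. for every $x\in\mathcal X$; thus $T_j$ is invertible as an operator onto its range. * **Non-reflection** (only if $\lambda<1$): at no $x\in\mathcal X$ with $m_1(x)\ne m_2(x)$ is $F(\cdot\mid x)$, the mixture of the laws of $m_j(x)+\epsilon_j$ with weights $\lambda,1-\lambda$, unchanged when both $m_1(x),m_2(x)$ are replaced by their reflections $2E[z\mid x]-m_j(x)$. (If $\lambda=\frac12$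 this says exactly that $F_1^\epsilon\ne F_2^\epsilon$.) **Theorem.** Suppose a structure $S=(\lambda,g_1,g_2,P_1,P_2)$ satisfies Assumptions E and F, Condition IV, invertibility and non-reflection. Then $g_1$ and $g_2$ are nonparametrically identified up to labeling. That is, let $S'=(\lambda',g_1',g_2',P_1',P_2')$ be any structure (with the same $\mathcal X,\mathcal G$) with independent errors which generates the same $F(\cdot\mid x)$ for all $x\in\mathcal X$; if $\lambda=1$, suppose moreover that $S'$ satisfies Assumption E at $x_0$ for some $\delta'>0$. If $\lambda<1$, then either $\lambda'=\lambda$, $g_1'=g_1$, $g_2'=g_2$, or $\lambda'=1-\lambda$, $g_1'=g_2$, $g_2'=g_1$. If $\lambda=1$, then $\lambda'=1$ and $g_1'=g_1$. Here equality with $g_j$ means equality $F_j(w\mid x)$-a.s. for every $x\in\mathcal X$. -/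

import Mathlib

open MeasureTheory ProbabilityTheory Filter Topology Set

noncomputable section

/-- A two-component switching regression with endogenous regressor `w ∈ ℝᵖ` and instrument
`x ∈ ℝᵏ`. With probability `lam` the first component is drawn, with probability `1 - lam` the
second. In component `j`, `law j x` is the conditional distribution of `(w, η_j)` given `x`, and
the outcome is `y = g_j(w) + η_j`. Components are indexed by `0, 1 : Fin 2`. -/
structure SwitchingIV (k p : ℕ) where
  lam : ℝ
  lam_mem : lam ∈ Ioc (0 : ℝ) 1
  g : Fin 2 → (Fin p → ℝ) → ℝ
  measurable_g : ∀ j, Measurable (g j)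
  law : Fin 2 → Kernel (Fin k → ℝ) ((Fin p → ℝ) × ℝ)
  markov : ∀ j, IsMarkovKernel (law j)

/-- The points that differ from `x₀` only in the first coordinate, and there by less than `δ`. -/
def lineNhd {k : ℕ} [NeZero k] (x₀ : Fin k → ℝ) (δ : ℝ) : Set (Fin k → ℝ) :=
  {x | |x 0 - x₀ 0| < δ ∧ ∀ i, i ≠ 0 → x i = x₀ i}

namespace SwitchingIV

variable {k p : ℕ}

/-- The conditional distribution `F_j(z | x)` of `z = (w, y) ∈ ℝᵖ⁺¹`, where `y = g_j(w) + η_j` is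
the last coordinate. -/
def zLaw (S : SwitchingIV k p) (j : Fin 2) (x : Fin k → ℝ) : Measure (Fin (p + 1) → ℝ) :=
  (S.law j x).map fun q => Fin.snoc (α := fun _ => ℝ) q.1 (S.g j q.1 + q.2)

/-- The conditional distribution `F_j(w | x)`. -/
def wLaw (S : SwitchingIV k p) (j : Fin 2) (x : Fin k → ℝ) : Measure (Fin p → ℝ) :=
  (S.law j x).map Prod.fst

/-- The weighted sum of a first and a second component. -/
def mix (S : SwitchingIV k p) (P Q : Measure (Fin (p + 1) → ℝ)) : Measure (Fin (p + 1) → ℝ) :=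
  ENNReal.ofReal S.lam • P + ENNReal.ofReal (1 - S.lam) • Q

/-- The observable conditional distribution `F(z | x)`. -/
def obsLaw (S : SwitchingIV k p) (x : Fin k → ℝ) : Measure (Fin (p + 1) → ℝ) :=
  S.mix (S.zLaw 0 x) (S.zLaw 1 x)

/-- The component mean `m_j(x) = ∫ z dF_j(z | x)`. -/
def mean (S : SwitchingIV k p) (j : Fin 2) (x : Fin k → ℝ) : Fin (p + 1) → ℝ :=
  fun i => ∫ z, z i ∂(S.zLaw j x)

/-- The observable mean `E[z | x]`. -/
def obsMean (S : SwitchingIV k p) (x : Fin k → ℝ) : Fin (p + 1) → ℝ :=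
  fun i => ∫ z, z i ∂(S.obsLaw x)

/-- The conditional distribution given `x` of `ε_j = z - m_j(x)`. -/
def errLaw (S : SwitchingIV k p) (j : Fin 2) (x : Fin k → ℝ) : Measure (Fin (p + 1) → ℝ) :=
  (S.zLaw j x).map fun z => z - S.mean j x

/-- The operator `T_j[f](x) = ∫ f(w) dF_j(w | x)`. -/
def ivOp (S : SwitchingIV k p) (j : Fin 2) (f : (Fin p → ℝ) → ℝ) (x : Fin k → ℝ) : ℝ :=
  ∫ w, f w ∂(S.wLaw j x)

/-- The domain of `T_j`, considered on a linear space `G` of functions. -/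
def ivDomain (S : SwitchingIV k p) (X : Set (Fin k → ℝ)) (G : Submodule ℝ ((Fin p → ℝ) → ℝ))
    (j : Fin 2) : Set ((Fin p → ℝ) → ℝ) :=
  {f | f ∈ G ∧ ∀ x ∈ X, Integrable f (S.wLaw j x)}

/-- Equality of functions of `w` up to sets that are null under `F_j(w | x)` for all `x ∈ X`. -/
def EqFor (S : SwitchingIV k p) (X : Set (Fin k → ℝ)) (j : Fin 2)
    (f f' : (Fin p → ℝ) → ℝ) : Prop :=
  ∀ x ∈ X, f =ᵐ[S.wLaw j x] f'

/-- `T_j` is invertible, as an operator from its domain in `G` (functions being identified up to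
null sets) onto its range in the functions on `X`. -/
def IvInvertible (S : SwitchingIV k p) (X : Set (Fin k → ℝ))
    (G : Submodule ℝ ((Fin p → ℝ) → ℝ)) (j : Fin 2) : Prop :=
  ∀ f ∈ S.ivDomain X G j, ∀ f' ∈ S.ivDomain X G j,
    (∀ x ∈ X, S.ivOp j f x = S.ivOp j f' x) → S.EqFor X j f f'

/-- The instrumental variables model on the instrument set `X` with parameter space `G` for the
structural functions: `z` has a conditional mean, and `E[η_j | x] = 0`. -/
structure IsModel (S : SwitchingIV k p) (X : Set (Fin k → ℝ))
    (G : Submodule ℝ ((Fin p → ℝ) → ℝ)) : Prop where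
  g_mem : ∀ j, S.g j ∈ G
  integrable_z : ∀ j, ∀ x ∈ X, ∀ i, Integrable (fun z : Fin (p + 1) → ℝ => z i) (S.zLaw j x)
  integrable_eta : ∀ j, ∀ x ∈ X, Integrable (fun q : (Fin p → ℝ) × ℝ => q.2) (S.law j x)
  mean_eta : ∀ j, ∀ x ∈ X, ∫ q, q.2 ∂(S.law j x) = 0

/-- The conditional distribution of `ε_j` given `x ∈ X` does not depend on `x`. -/
def IndepErrors (S : SwitchingIV k p) (X : Set (Fin k → ℝ)) : Prop :=
  ∀ j, ∃ F : Measure (Fin (p + 1) → ℝ), ∀ x ∈ X, S.errLaw j x = F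

/-- Errors independent of `x`; coordinatewise non-parallel mean functions along the first
coordinate of `x` near `x₀` (when there are two components); continuity at `x₀`. -/
structure ShiftAssumption [NeZero k] (S : SwitchingIV k p) (X : Set (Fin k → ℝ))
    (x₀ : Fin k → ℝ) (δ : ℝ) : Prop where
  nhd_subset : lineNhd x₀ δ ⊆ X
  indep : S.IndepErrors X
  nonparallel : S.lam < 1 → ∀ x ∈ lineNhd x₀ δ, x ≠ x₀ → ∀ i,
    S.mean 0 x₀ i - S.mean 0 x i ≠ S.mean 1 x₀ i - S.mean 1 x i
  continuous : ∀ j, ContinuousWithinAt (S.mean j) X x₀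

/-- The moment generating function `M_j(t) = ∫ exp(tᵀε) dF_j^ε(ε)`; the error distribution is read
off at `x₀`. -/
def errMgf (S : SwitchingIV k p) (x₀ : Fin k → ℝ) (j : Fin 2) (t : Fin (p + 1) → ℝ) : ℝ :=
  ∫ e, Real.exp (t ⬝ᵥ e) ∂(S.errLaw j x₀)

/-- `h_i(c, t) = exp(t D_i(x₀) (1 - c)) M_2(t e_i) / M_1(t e_i)`, with `D = m_2 - m_1`. -/
def h (S : SwitchingIV k p) (x₀ : Fin k → ℝ) (i : Fin (p + 1)) (c t : ℝ) : ℝ :=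
  Real.exp (t * (S.mean 1 x₀ i - S.mean 0 x₀ i) * (1 - c)) *
    (S.errMgf x₀ 1 (t • Pi.single i 1) / S.errMgf x₀ 0 (t • Pi.single i 1))

/-- `h_i(±c, t) = O(1)` or `1 / h_i(±c, t) = O(1)` along the filter `l`. -/
def hBounded (S : SwitchingIV k p) (x₀ : Fin k → ℝ) (i : Fin (p + 1)) (c : ℝ)
    (l : Filter ℝ) : Prop :=
  (S.h x₀ i c =O[l] (fun _ => (1 : ℝ)) ∧ S.h x₀ i (-c) =O[l] (fun _ => (1 : ℝ))) ∨
  ((fun t => 1 / S.h x₀ i c t) =O[l] (fun _ => (1 : ℝ)) ∧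
    (fun t => 1 / S.h x₀ i (-c) t) =O[l] (fun _ => (1 : ℝ)))

/-- Everywhere finite moment generating functions, and their behaviour at `±∞`. -/
structure MgfAssumption (S : SwitchingIV k p) (x₀ : Fin k → ℝ) : Prop where
  domain : ∀ j, ∀ t : Fin (p + 1) → ℝ,
    Integrable (fun e => Real.exp (t ⬝ᵥ e)) (S.errLaw j x₀)
  tails : ∃ c > 0, (∀ i, S.hBounded x₀ i c atTop) ∧ (∀ i, S.hBounded x₀ i c atBot)

/-- The moment generating function `M(t | x)` of `z` given `x`. -/
def obsMgf (S : SwitchingIV k p) (t : Fin (p + 1) → ℝ) (x : Fin k → ℝ) : ℝ :=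
  ∫ z, Real.exp (t ⬝ᵥ z) ∂(S.obsLaw x)

/-- `R(t, x) = M(t | x) / M(t | x₀)`. -/
def R (S : SwitchingIV k p) (x₀ : Fin k → ℝ) (t : Fin (p + 1) → ℝ) (x : Fin k → ℝ) : ℝ :=
  S.obsMgf t x / S.obsMgf t x₀

/-- `(1/t) log R(t e_i, x)` tends to `L` along `l`. -/
def SlopeLimit (S : SwitchingIV k p) (x₀ x : Fin k → ℝ) (i : Fin (p + 1)) (l : Filter ℝ)
    (L : ℝ) : Prop :=
  Tendsto (fun t : ℝ => 1 / t * Real.log (S.R x₀ (t • Pi.single i 1) x)) l (𝓝 L)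

/-- The observable condition: for each coordinate of `w`, at some `x` near `x₀`, either the two
limits of `(1/t) log R(t e_i, x)` differ, or `λ_c → 1` as `c ↓ 0`. -/
def SlopeCondition [NeZero k] (S : SwitchingIV k p) (x₀ : Fin k → ℝ) (δ : ℝ) : Prop :=
  (∀ i : Fin p, ∃ x ∈ lineNhd x₀ δ, ∃ Lp Lm : ℝ,
    S.SlopeLimit x₀ x i.castSucc atTop Lp ∧ S.SlopeLimit x₀ x i.castSucc atBot Lm ∧ Lp ≠ Lm) ∨
  (∀ i : Fin p, ∃ x ∈ lineNhd x₀ δ, ∃ Lp Lm : ℝ,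
    S.SlopeLimit x₀ x i.castSucc atTop Lp ∧ S.SlopeLimit x₀ x i.castSucc atBot Lm ∧
    Tendsto (fun c : ℝ =>
      (S.obsMean x i.castSucc - S.obsMean x₀ i.castSucc - (1 + c) * Lm) / (Lp - (1 + c) * Lm))
      (𝓝[>] 0) (𝓝 1))

/-- With two components, at no `x ∈ X` with `m_1(x) ≠ m_2(x)` is `F(z | x)` unchanged when both
component means are reflected about `E[z | x]`. For `lam = 1/2` the reflection interchanges the two
means, and this says that the two error distributions differ. -/
def NoReflection (S : SwitchingIV k p) (X : Set (Fin k → ℝ)) : Prop :=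
  S.lam < 1 → ∀ x ∈ X, S.mean 0 x ≠ S.mean 1 x →
    S.obsLaw x ≠ S.mix
      ((S.errLaw 0 x).map fun e => e + ((2 : ℝ) • S.obsMean x - S.mean 0 x))
      ((S.errLaw 1 x).map fun e => e + ((2 : ℝ) • S.obsMean x - S.mean 1 x))

/-- `S'` has the structural functions of `S`, up to labeling. With a single component
(`lam = 1`) only the first structural function is meaningful. -/
def SameStructural (S S' : SwitchingIV k p) (X : Set (Fin k → ℝ)) : Prop :=
  (S'.lam = S.lam ∧ S.EqFor X 0 (S'.g 0) (S.g 0) ∧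
    (S.lam < 1 → S.EqFor X 1 (S'.g 1) (S.g 1))) ∨
  (S.lam < 1 ∧ S'.lam = 1 - S.lam ∧ S.EqFor X 0 (S'.g 1) (S.g 0) ∧
    S.EqFor X 1 (S'.g 0) (S.g 1))

end SwitchingIV

end

/-! The observable moment generating function at `x` is a sum over the two components of weight
times `exp (t ⬝ᵥ m_j(x))` times the error MGF. As `x → x₀` along a sequence, it takes the form `exp
(t ⬝ᵥ a n) * A t + exp (t ⬝ᵥ b n) * B t` with fixed positive `A`, `B` and shifts `a n ≠ b n` tending
to zero. A rival structure gives the same functions with some `A'`, `B'`, `a'`, `b'`; its means stay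
bounded because the observable MGF does, so after passing to a subsequence and recentring its shifts
tend to zero as well.

On a generic line, two values of `n` give a linear system for the shares of the second components.
If it is nonsingular, Cramer's rule writes these shares as quotients of exponential sums with
arbitrarily small frequencies. The exponential growth rate of such a quotient must vanish, which
makes the quotient constant near infinity (`eventually_const_of_expSpan_quotient`); singular systems
are handled by the same principle. Linear independence of exponentials then matches the shifts up to
labeling for some `n` (`exponents_unique`), and solving for `A`, `B` at that `n` matches the
components (`components_unique`).

Since errors are centered, the components determine weights and error laws (`weight_law_unique`). At
each `x`, first and second moments leave only the true means and their reflection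
(`mix_means_unique`); non-reflection excludes the latter. The component laws being known, `T_j g_j`
is the last coordinate of `m_j`, and invertibility gives `g_j`. For `lam = 1` the same argument with
the structures interchanged shows that a rival cannot have two components. -/

/-! ### Exponential sums and their quotients at infinity. -/

/-- The exponential sums on the line with frequencies in `[-r, r]`. -/
noncomputable def expSpan (r : ℝ) : Submodule ℝ (ℝ → ℝ) :=
  Submodule.span ℝ ((fun ω t => Real.exp (ω * t)) '' Icc (-r) r)

lemma exp_mem_expSpan {r ω : ℝ} (h : |ω| ≤ r) : (fun t => Real.exp (ω * t)) ∈ expSpan r :=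
  Submodule.subset_span ⟨ω, abs_le.1 h, rfl⟩

lemma mul_mem_expSpan {r s : ℝ} {f g : ℝ → ℝ} (hf : f ∈ expSpan r) (hg : g ∈ expSpan s) :
    f * g ∈ expSpan (r + s) := by
  have h := Submodule.mul_mem_mul hf hg
  rw [expSpan, expSpan, Submodule.span_mul_span] at h
  refine Submodule.span_mono ?_ h
  rintro _ ⟨_, ⟨a, ha, rfl⟩, _, ⟨b, hb, rfl⟩, rfl⟩
  refine ⟨a + b, ⟨by linarith [ha.1, hb.1], by linarith [ha.2, hb.2]⟩, ?_⟩
  funext t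
  simp [add_mul, Real.exp_add]

/-- A nonzero exponential sum is asymptotic to the term with the largest frequency. -/
lemma tendsto_expSum (l : ℝ →₀ ℝ) (hl : l ≠ 0) :
    ∃ ω ∈ l.support, Tendsto
      (fun t => (l.sum fun η c => c * Real.exp (η * t)) * Real.exp (-(ω * t))) atTop (𝓝 (l ω)) := by
  have hne : l.support.Nonempty := Finsupp.support_nonempty_iff.2 hl
  refine ⟨l.support.max' hne, Finset.max'_mem _ _, ?_⟩
  set ω := l.support.max' hne with hω
  have h : Tendsto (fun t => ∑ η ∈ l.support, l η * Real.exp ((η - ω) * t)) atTop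
      (𝓝 (∑ η ∈ l.support, if η = ω then l ω else 0)) := by
    refine tendsto_finsetSum _ fun η hη => ?_
    split_ifs with h
    · simp [h]
    · have hlt : η - ω < 0 :=
        sub_neg.2 (lt_of_le_of_ne (Finset.le_max' _ _ hη) h)
      have := Real.tendsto_exp_atBot.comp (tendsto_id.const_mul_atTop_of_neg hlt)
      simpa using this.const_mul (l η)
  rw [Finset.sum_ite_eq' l.support ω, if_pos (Finset.max'_mem _ _)] at h
  refine h.congr fun t => ?_
  rw [Finsupp.sum, Finset.sum_mul]
  refine Finset.sum_congr rfl fun η _ => ?_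
  rw [mul_assoc, ← Real.exp_add]
  ring_nf

lemma eq_zero_of_expSum_eq_zero (l : ℝ →₀ ℝ)
    (h : ∀ᶠ t in atTop, (l.sum fun η c => c * Real.exp (η * t)) = 0) : l = 0 := by
  by_contra hl
  obtain ⟨ω, hω, hlim⟩ := tendsto_expSum l hl
  have h0 : Tendsto (fun t => (l.sum fun η c => c * Real.exp (η * t)) * Real.exp (-(ω * t)))
      atTop (𝓝 0) :=
    tendsto_const_nhds.congr' (h.mono fun t ht => by simp [ht])
  exact Finsupp.mem_support_iff.1 hω (tendsto_nhds_unique hlim h0)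

lemma exists_tendsto_of_mem_expSpan {r : ℝ} {f : ℝ → ℝ} (hf : f ∈ expSpan r)
    (h0 : ¬ ∀ᶠ t in atTop, f t = 0) :
    ∃ ω, |ω| ≤ r ∧ ∃ c ≠ 0, Tendsto (fun t => f t * Real.exp (-(ω * t))) atTop (𝓝 c) := by
  rw [expSpan, Finsupp.mem_span_image_iff_linearCombination] at hf
  obtain ⟨l, hl, rfl⟩ := hf
  have hsum : ∀ t, Finsupp.linearCombination ℝ (fun ω t => Real.exp (ω * t)) l t
      = l.sum fun η c => c * Real.exp (η * t) := fun t => by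
    simp [Finsupp.linearCombination_apply, Finsupp.sum, Finset.sum_apply]
  have hne : l ≠ 0 := by
    rintro rfl
    simp at h0
  obtain ⟨ω, hω, hlim⟩ := tendsto_expSum l hne
  exact ⟨ω, abs_le.2 ((Finsupp.mem_supported ℝ l).1 hl hω), l ω, Finsupp.mem_support_iff.1 hω,
    hlim.congr fun t => by rw [hsum]⟩

/-- A function which is, with arbitrarily small frequencies, a quotient of exponential sums has a
nonzero limit at infinity, unless it vanishes. -/
lemma tendsto_of_expSpan_quotient {q : ℝ → ℝ}
    (hq : ∀ ε > 0, ∃ f ∈ expSpan ε, ∃ g ∈ expSpan ε, (¬ ∀ᶠ t in atTop, g t = 0) ∧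
      ∀ᶠ t in atTop, q t * g t = f t)
    (h0 : ¬ ∀ᶠ t in atTop, q t = 0) : ∃ C ≠ 0, Tendsto q atTop (𝓝 C) := by
  -- The growth rate of `q` is the difference of the leading frequencies of `f` and `g`.
  have key : ∀ ε > 0, ∃ γ, |γ| ≤ 2 * ε ∧ ∃ C ≠ 0,
      Tendsto (fun t => q t * Real.exp (-(γ * t))) atTop (𝓝 C) := by
    intro ε hε
    obtain ⟨f, hf, g, hg, hg0, hfg⟩ := hq ε hε
    obtain ⟨β, hβ, b, hb, hgl⟩ := exists_tendsto_of_mem_expSpan hg hg0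
    have hgne : ∀ᶠ t in atTop, g t ≠ 0 := by
      filter_upwards [hgl.eventually_ne hb] with t ht h
      simp [h] at ht
    have hf0 : ¬ ∀ᶠ t in atTop, f t = 0 := fun h => h0 <| by
      filter_upwards [h, hfg, hgne] with t h1 h2 h3
      rw [h1] at h2
      exact (mul_eq_zero.1 h2).resolve_right h3
    obtain ⟨α, hα, a, ha, hfl⟩ := exists_tendsto_of_mem_expSpan hf hf0
    refine ⟨α - β, (abs_sub _ _).trans (by linarith), a / b, div_ne_zero ha hb,
      (hfl.div hgl hb).congr' ?_⟩
    filter_upwards [hfg, hgne] with t h1 h2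
    have := (Real.exp_pos (-(β * t))).ne'
    rw [Pi.div_apply, ← h1, show -((α - β) * t) = -(α * t) - -(β * t) by ring, Real.exp_sub]
    field_simp
  have huniq : ∀ γ γ' C C' : ℝ, C ≠ 0 → C' ≠ 0 →
      Tendsto (fun t => q t * Real.exp (-(γ * t))) atTop (𝓝 C) →
      Tendsto (fun t => q t * Real.exp (-(γ' * t))) atTop (𝓝 C') → γ ≤ γ' := by
    intro γ γ' C C' hC hC' h h'
    by_contra! hlt
    have h1 := Real.tendsto_exp_atBot.comp
      ((tendsto_id (α := ℝ)).const_mul_atTop_of_neg (sub_neg.2 hlt))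
    have h2 := h'.mul h1
    rw [mul_zero] at h2
    refine hC (tendsto_nhds_unique h (h2.congr fun t => ?_))
    simp only [Function.comp_apply, id]
    rw [mul_assoc, ← Real.exp_add]
    ring_nf
  obtain ⟨γ, -, C, hC, hlim⟩ := key 1 one_pos
  -- The rate is unique, yet `ε = |γ| / 4` bounds it by `|γ| / 2`.
  have hγ : γ = 0 := by
    by_contra hne
    obtain ⟨γ', hγ', C', hC', hlim'⟩ := key (|γ| / 4) (by positivity)
    have := le_antisymm (huniq _ _ _ _ hC hC' hlim hlim') (huniq _ _ _ _ hC' hC hlim' hlim)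
    have hpos := abs_pos.2 hne
    rw [← this] at hγ'
    linarith
  exact ⟨C, hC, by simpa [hγ] using hlim⟩

/-- A function which is, with arbitrarily small frequencies, a quotient of exponential sums is
constant near infinity. -/
lemma eventually_const_of_expSpan_quotient {q : ℝ → ℝ}
    (hq : ∀ ε > 0, ∃ f ∈ expSpan ε, ∃ g ∈ expSpan ε, (¬ ∀ᶠ t in atTop, g t = 0) ∧
      ∀ᶠ t in atTop, q t * g t = f t) :
    ∃ C, ∀ᶠ t in atTop, q t = C := by
  by_cases h0 : ∀ᶠ t in atTop, q t = 0
  · exact ⟨0, h0⟩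
  obtain ⟨C, -, hlim⟩ := tendsto_of_expSpan_quotient hq h0
  refine ⟨C, ?_⟩
  by_contra h
  -- `q - C` is a quotient of the same kind, so if it did not vanish near infinity its limit would
  -- be nonzero; but that limit is `0`.
  obtain ⟨C', hC', hlim'⟩ := tendsto_of_expSpan_quotient (q := fun t => q t - C) (fun ε hε => by
    obtain ⟨f, hf, g, hg, hg0, hfg⟩ := hq ε hε
    refine ⟨f - C • g, sub_mem hf (Submodule.smul_mem _ _ hg), g, hg, hg0, ?_⟩
    filter_upwards [hfg] with t ht
    simp [sub_mul, ht]) (by simpa [sub_eq_zero] using h)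
  refine hC' (tendsto_nhds_unique hlim' ?_)
  simpa using hlim.sub_const C

/-! ### Exponents of two-point mixtures on a line. -/

/-- Uniqueness of two-point exponential mixtures. -/
lemma two_point_unique {a b a' b' c c' : ℝ} (hab : a ≠ b) (hc : c ∈ Ioo (0 : ℝ) 1)
    (h : ∀ᶠ t in atTop, Real.exp (a * t) * (1 - c) + Real.exp (b * t) * c
      = Real.exp (a' * t) * (1 - c') + Real.exp (b' * t) * c') :
    (a = a' ∧ b = b') ∨ (a = b' ∧ b = a') := by
  have hl := eq_zero_of_expSum_eq_zero
    (Finsupp.single a (1 - c) + Finsupp.single b c - Finsupp.single a' (1 - c')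
      - Finsupp.single b' c') (by
    filter_upwards [h] with t ht
    rw [Finsupp.sum_sub_index (by intros; ring), Finsupp.sum_sub_index (by intros; ring),
      Finsupp.sum_add_index' (by simp) (by intros; ring)]
    simp only [Finsupp.sum_single_index, zero_mul]
    linarith)
  -- The coefficients `1 - c` at `a` and `c` at `b` are nonzero, so each of these frequencies must
  -- be cancelled by `a'` or `b'`.
  have ha := DFunLike.congr_fun hl a
  have hb := DFunLike.congr_fun hl b
  simp only [Finsupp.coe_sub, Finsupp.coe_add, Pi.sub_apply, Pi.add_apply, Finsupp.single_apply,
    Finsupp.coe_zero, Pi.zero_apply] at ha hb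
  obtain ⟨h0, h1⟩ := hc
  grind

/-- Linear independence of exponentials, for the case of `exponents_unique` in which the two
frequency differences are proportional. -/
lemma exp_sub_exp_unique {a b a' b' C : ℝ} (hab : a ≠ b)
    (h : ∀ᶠ t in atTop, Real.exp (b' * t) - Real.exp (a' * t)
      = C * (Real.exp (b * t) - Real.exp (a * t))) :
    (a' = b' ∧ C = 0) ∨ (a = a' ∧ b = b') ∨ (a = b' ∧ b = a') := by
  have hl := eq_zero_of_expSum_eq_zero
    (Finsupp.single b' 1 - Finsupp.single a' 1 - Finsupp.single b C + Finsupp.single a C) (by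
    filter_upwards [h] with t ht
    rw [Finsupp.sum_add_index' (by simp) (by intros; ring),
      Finsupp.sum_sub_index (by intros; ring), Finsupp.sum_sub_index (by intros; ring)]
    simp only [Finsupp.sum_single_index, zero_mul]
    linarith)
  have ha := DFunLike.congr_fun hl a
  have hb := DFunLike.congr_fun hl b
  have ha' := DFunLike.congr_fun hl a'
  have hb' := DFunLike.congr_fun hl b'
  simp only [Finsupp.coe_sub, Finsupp.coe_add, Pi.sub_apply, Pi.add_apply, Finsupp.single_apply,
    Finsupp.coe_zero, Pi.zero_apply] at ha hb ha' hb'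
  grind

/-- Two-point exponential mixtures with fixed weight functions and exponents tending to zero
determine the exponents up to labeling. -/
lemma exponents_unique {q q' : ℝ → ℝ} (hq : ∀ t, q t ∈ Ioo (0 : ℝ) 1) {a b a' b' : ℕ → ℝ}
    (ha : Tendsto a atTop (𝓝 0)) (hb : Tendsto b atTop (𝓝 0))
    (ha' : Tendsto a' atTop (𝓝 0)) (hb' : Tendsto b' atTop (𝓝 0)) (hab : ∀ n, a n ≠ b n)
    (h : ∀ n t, Real.exp (a n * t) * (1 - q t) + Real.exp (b n * t) * q t
      = Real.exp (a' n * t) * (1 - q' t) + Real.exp (b' n * t) * q' t) :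
    ∃ n, (a n = a' n ∧ b n = b' n) ∨ (a n = b' n ∧ b n = a' n) := by
  set e : ℝ → ℝ → ℝ := fun ω t => Real.exp (ω * t) with he
  set u : ℕ → ℝ → ℝ := fun n => e (b n) - e (a n) with hu
  set v : ℕ → ℝ → ℝ := fun n => e (b' n) - e (a' n) with hv
  set w : ℕ → ℝ → ℝ := fun n => e (a n) - e (a' n) with hw
  have hrel : ∀ n t, w n t + u n t * q t = v n t * q' t := fun n t => by
    simp only [hw, hu, hv, he, Pi.sub_apply]
    linear_combination h n t
  have hune : ∀ n, ∀ᶠ t in atTop, u n t ≠ 0 := fun n => by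
    filter_upwards [eventually_gt_atTop 0] with t ht h0
    have h1 : b n * t = a n * t := Real.exp_injective (sub_eq_zero.1 h0)
    exact hab n (mul_right_cancel₀ ht.ne' h1).symm
  have hune' : ∀ n, ¬ ∀ᶠ t in atTop, u n t = 0 := fun n h0 =>
    (((hune n).and h0).exists).elim fun t ht => ht.1 ht.2
  have hsmall : ∀ ε > 0, ∃ N, ∀ n ≥ N,
      u n ∈ expSpan ε ∧ v n ∈ expSpan ε ∧ w n ∈ expSpan ε := by
    intro ε hε
    have key : ∀ c : ℕ → ℝ, Tendsto c atTop (𝓝 0) → ∀ᶠ n in atTop, e (c n) ∈ expSpan ε := by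
      intro c hc
      filter_upwards [Metric.tendsto_nhds.1 hc ε hε] with n hn
      exact exp_mem_expSpan (by simpa using hn.le)
    obtain ⟨N, hN⟩ := eventually_atTop.1
      ((key a ha).and ((key b hb).and ((key a' ha').and (key b' hb'))))
    refine ⟨N, fun n hn => ?_⟩
    obtain ⟨h1, h2, h3, h4⟩ := hN n hn
    exact ⟨sub_mem h2 h1, sub_mem h4 h3, sub_mem h1 h3⟩
  -- The relations `hrel` for `n` and `m` are linear in `q`, `q'`, with determinant `u m * v n - u n
  -- * v m` up to sign. `H` says that all late pairs are singular near infinity.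
  by_cases H : ∃ N, ∀ n ≥ N, ∀ m ≥ N, ∀ᶠ t in atTop, v m t * u n t = u m t * v n t
  · obtain ⟨N, hN⟩ := H
    -- The ratio `v n / u n` does not depend on `n`, so it is a quotient with arbitrarily small
    -- frequencies.
    obtain ⟨C, hC⟩ := eventually_const_of_expSpan_quotient (q := fun t => v N t / u N t) (by
      intro ε hε
      obtain ⟨M, hM⟩ := hsmall ε hε
      obtain ⟨hun, hvn, -⟩ := hM (max M N) (le_max_left _ _)
      refine ⟨_, hvn, _, hun, hune' _, ?_⟩
      filter_upwards [hN (max M N) (le_max_right _ _) N le_rfl, hune N] with t h1 h2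
      rw [div_mul_eq_mul_div, h1, mul_div_cancel_left₀ _ h2])
    have hall : ∀ n ≥ N, ∀ᶠ t in atTop, v n t = C * u n t := by
      intro n hn
      filter_upwards [hC, hN n hn N le_rfl, hune N] with t h1 h2 h3
      rw [← h1, div_mul_eq_mul_div, h2, mul_div_cancel_left₀ _ h3]
    -- If `C = 0`, the rival exponents coincide, `q'` drops out, and `q = -w n / u n` is itself such
    -- a quotient.
    by_cases hC0 : C = 0
    · have hv0 : ∀ n ≥ N, a' n = b' n := by
        intro n hn
        rcases exp_sub_exp_unique (hab n) (hall n hn) with h1 | h1 | h1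
        · exact h1.1
        all_goals
          exfalso
          obtain ⟨t, h2, h3, h4⟩ :=
            ((hall n hn).and ((hune n).and (eventually_gt_atTop 0))).exists
          rw [hC0, zero_mul] at h2
          have h5 : b' n * t = a' n * t := Real.exp_injective (sub_eq_zero.1 h2)
          have h6 := mul_right_cancel₀ h4.ne' h5
          exact hab n (by grind)
      obtain ⟨c, hc⟩ := eventually_const_of_expSpan_quotient (q := q) (by
        intro ε hε
        obtain ⟨M, hM⟩ := hsmall ε hε
        obtain ⟨hun, -, hwn⟩ := hM (max M N) (le_max_left _ _)
        refine ⟨_, Submodule.neg_mem _ hwn, _, hun, hune' _, Eventually.of_forall fun t => ?_⟩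
        have h1 := hrel (max M N) t
        simp only [hv, hv0 _ (le_max_right M N), sub_self, Pi.zero_apply, zero_mul] at h1
        simp only [Pi.neg_apply]
        linarith)
      obtain ⟨t₀, ht₀⟩ := hc.exists
      -- As `a' N = b' N`, the weight `c'` is immaterial.
      refine ⟨N, two_point_unique (c := c) (c' := 0) (hab N) (ht₀ ▸ hq t₀) ?_⟩
      filter_upwards [hc] with t ht
      rw [← ht, h N t, hv0 N le_rfl]
      ring
    · refine ⟨N, ?_⟩
      rcases exp_sub_exp_unique (hab N) (hall N le_rfl) with h1 | h1 | h1
      · exact absurd h1.2 hC0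
      · exact Or.inl h1
      · exact Or.inr h1
  · push Not at H
    have hfreq : ∀ ε > 0, ∃ n m, (u n ∈ expSpan (ε / 2) ∧ v n ∈ expSpan (ε / 2) ∧
        w n ∈ expSpan (ε / 2)) ∧ (u m ∈ expSpan (ε / 2) ∧ v m ∈ expSpan (ε / 2) ∧
        w m ∈ expSpan (ε / 2)) ∧ ¬ ∀ᶠ t in atTop, (u n * v m - u m * v n) t = 0 := by
      intro ε hε
      obtain ⟨N, hN⟩ := hsmall (ε / 2) (half_pos hε)
      obtain ⟨n, hn, m, hm, hnm⟩ := H N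
      refine ⟨n, m, hN n hn, hN m hm, fun h0 => ?_⟩
      obtain ⟨t, h1, h2⟩ := (hnm.and_eventually h0).exists
      simp only [Pi.sub_apply, Pi.mul_apply] at h2
      exact h1 (by linarith)
    obtain ⟨c, hc⟩ := eventually_const_of_expSpan_quotient (q := q) (by
      intro ε hε
      obtain ⟨n, m, ⟨h1, h2, h3⟩, ⟨h4, h5, h6⟩, h7⟩ := hfreq ε hε
      have hmul := fun {f g : ℝ → ℝ} hf hg => add_halves ε ▸
        mul_mem_expSpan (r := ε / 2) (s := ε / 2) (f := f) (g := g) hf hg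
      -- Cramer's rule; products of sums with frequencies at most `ε / 2` have frequencies at most
      -- `ε`.
      refine ⟨w m * v n - w n * v m, sub_mem (hmul h6 h2) (hmul h3 h5), u n * v m - u m * v n,
        sub_mem (hmul h1 h5) (hmul h4 h2), h7, Eventually.of_forall fun t => ?_⟩
      simp only [Pi.sub_apply, Pi.mul_apply]
      linear_combination v m t * hrel n t - v n t * hrel m t)
    obtain ⟨c', hc'⟩ := eventually_const_of_expSpan_quotient (q := q') (by
      intro ε hε
      obtain ⟨n, m, ⟨h1, h2, h3⟩, ⟨h4, h5, h6⟩, h7⟩ := hfreq ε hε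
      have hmul := fun {f g : ℝ → ℝ} hf hg => add_halves ε ▸
        mul_mem_expSpan (r := ε / 2) (s := ε / 2) (f := f) (g := g) hf hg
      refine ⟨w m * u n - w n * u m, sub_mem (hmul h6 h1) (hmul h3 h4), u n * v m - u m * v n,
        sub_mem (hmul h1 h5) (hmul h4 h2), h7, Eventually.of_forall fun t => ?_⟩
      simp only [Pi.sub_apply, Pi.mul_apply]
      linear_combination u m t * hrel n t - u n t * hrel m t)
    obtain ⟨t₀, ht₀⟩ := hc.exists
    refine ⟨0, two_point_unique (c := c) (c' := c') (hab 0) (ht₀ ▸ hq t₀) ?_⟩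
    filter_upwards [hc, hc'] with t ht ht'
    rw [← ht, ← ht', h 0 t]

/-! ### From a generic line to several variables. -/

lemma ae_dotProduct_ne_zero {d : ℕ} {v : Fin d → ℝ} (hv : v ≠ 0) :
    ∀ᵐ t : Fin d → ℝ, t ⬝ᵥ v ≠ 0 := by
  let L : (Fin d → ℝ) →ₗ[ℝ] ℝ := (dotProductBilin ℝ ℝ).flip v
  have hL : ∀ t, L t = t ⬝ᵥ v := fun t => rfl
  have hker : LinearMap.ker L ≠ ⊤ := by
    intro h
    refine hv (dotProduct_self_eq_zero.1 ?_)
    rw [← hL]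
    exact LinearMap.mem_ker.1 (h ▸ Submodule.mem_top)
  have hset : {t : Fin d → ℝ | ¬ t ⬝ᵥ v ≠ 0} = (LinearMap.ker L : Set (Fin d → ℝ)) := by
    ext t
    simp [hL]
  rw [ae_iff, hset]
  exact Measure.addHaar_submodule _ _ hker

/-- Countably many nonzero vectors are simultaneously non-orthogonal to some vector. -/
lemma exists_dotProduct_ne_zero {d : ℕ} {V : Set (Fin d → ℝ)} (hV : V.Countable) :
    ∃ t : Fin d → ℝ, ∀ v ∈ V, t ⬝ᵥ v = 0 → v = 0 := by
  have hae : ∀ v ∈ V, ∀ᵐ t : Fin d → ℝ, t ⬝ᵥ v = 0 → v = 0 := by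
    intro v _
    by_cases hv : v = 0
    · exact Eventually.of_forall fun _ _ => hv
    · filter_upwards [ae_dotProduct_ne_zero hv] with t ht h
      exact absurd h ht
  exact ((ae_ball_iff hV).2 hae).exists

/-- If the functions `A, B` and `A', B'` have the same combinations with exponential weights for
exponents tending to zero, and the exponents of `A` and `B` never agree, then the two pairs of
functions agree up to labeling. -/
lemma components_unique {d : ℕ} {A B A' B' : (Fin d → ℝ) → ℝ}
    (hA : ∀ t, 0 < A t) (hB : ∀ t, 0 < B t)
    (hAc : Continuous A) (hAc' : Continuous A') (hBc' : Continuous B')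
    {a b a' b' : ℕ → Fin d → ℝ}
    (ha : Tendsto a atTop (𝓝 0)) (hb : Tendsto b atTop (𝓝 0))
    (ha' : Tendsto a' atTop (𝓝 0)) (hb' : Tendsto b' atTop (𝓝 0)) (hab : ∀ n, a n ≠ b n)
    (h0 : ∀ t, A t + B t = A' t + B' t)
    (h : ∀ n t, Real.exp (t ⬝ᵥ a n) * A t + Real.exp (t ⬝ᵥ b n) * B t
      = Real.exp (t ⬝ᵥ a' n) * A' t + Real.exp (t ⬝ᵥ b' n) * B' t) :
    (A = A' ∧ B = B') ∨ (A = B' ∧ B = A') := by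
  -- Along this `τ`, equality of projected shifts implies equality of the shifts themselves.
  obtain ⟨τ, hτ⟩ := exists_dotProduct_ne_zero (V := range (fun n => a n - b n) ∪
    range (fun n => a n - a' n) ∪ range (fun n => b n - b' n) ∪ range (fun n => a n - b' n) ∪
    range (fun n => b n - a' n)) (by
      simp only [countable_union, countable_range, and_self])
  have hlim : ∀ c : ℕ → Fin d → ℝ, Tendsto c atTop (𝓝 0) →
      Tendsto (fun n => τ ⬝ᵥ c n) atTop (𝓝 0) := by
    intro c hc
    have hcont : Continuous fun v : Fin d → ℝ => τ ⬝ᵥ v := by fun_prop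
    simpa [Function.comp_def] using (hcont.tendsto 0).comp hc
  have heq : ∀ u v : Fin d → ℝ, u - v ∈ range (fun n => a n - b n) ∪
      range (fun n => a n - a' n) ∪ range (fun n => b n - b' n) ∪ range (fun n => a n - b' n) ∪
      range (fun n => b n - a' n) → τ ⬝ᵥ u = τ ⬝ᵥ v → u = v := by
    intro u v huv hd
    exact sub_eq_zero.1 (hτ _ huv (by rw [dotProduct_sub, hd, sub_self]))
  have hpos : ∀ t, 0 < A t + B t := fun t => add_pos (hA t) (hB t)
  obtain ⟨n, hn⟩ := exponents_unique
    -- Dividing by `A + B = A' + B'` makes the weights in each mixture sum to one.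
    (q := fun s => B (s • τ) / (A (s • τ) + B (s • τ)))
    (q' := fun s => B' (s • τ) / (A (s • τ) + B (s • τ)))
    (fun s => ⟨div_pos (hB _) (hpos _), by
      rw [div_lt_one (hpos _)]
      linarith [hA (s • τ)]⟩)
    (hlim a ha) (hlim b hb) (hlim a' ha') (hlim b' hb')
    (fun n hn => hab n (heq _ _ (by simp) hn)) (by
      intro n s
      have h1 := h n (s • τ)
      simp only [smul_dotProduct, smul_eq_mul, mul_comm s] at h1
      have h2 := (hpos (s • τ)).ne'
      field_simp
      simp only [mul_comm s]
      linear_combination h1 - Real.exp (τ ⬝ᵥ a' n * s) * h0 (s • τ))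
  -- With the shifts matched at `n`, the equations `h0` and `h n` determine the components off the
  -- hyperplane orthogonal to `a n - b n`; continuity does the rest.
  have hdense : Dense {t : Fin d → ℝ | t ⬝ᵥ (a n - b n) ≠ 0} :=
    Measure.dense_of_ae (ae_dotProduct_ne_zero (sub_ne_zero.2 (hab n)))
  have hexp : ∀ t : Fin d → ℝ, t ⬝ᵥ (a n - b n) ≠ 0 →
      Real.exp (t ⬝ᵥ a n) - Real.exp (t ⬝ᵥ b n) ≠ 0 := by
    intro t ht h1
    rw [dotProduct_sub] at ht
    exact ht (sub_eq_zero.2 (Real.exp_injective (sub_eq_zero.1 h1)))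
  rcases hn with ⟨h1, h2⟩ | ⟨h1, h2⟩
  · have h1 := heq _ _ (by simp) h1
    have h2 := heq _ _ (by simp) h2
    have hAA : A = A' := by
      refine hAc.ext_on hdense hAc' fun t ht => ?_
      have h3 := h n t
      rw [← h1, ← h2] at h3
      refine mul_left_cancel₀ (hexp t ht) ?_
      linear_combination h3 - Real.exp (t ⬝ᵥ b n) * h0 t
    refine Or.inl ⟨hAA, funext fun t => ?_⟩
    have := h0 t
    rw [hAA] at this
    exact add_left_cancel this
  · have h1 := heq _ _ (by simp) h1
    have h2 := heq _ _ (by simp) h2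
    have hAB : A = B' := by
      refine hAc.ext_on hdense hBc' fun t ht => ?_
      have h3 := h n t
      rw [← h1, ← h2] at h3
      refine mul_left_cancel₀ (hexp t ht) ?_
      linear_combination h3 - Real.exp (t ⬝ᵥ b n) * h0 t
    refine Or.inr ⟨hAB, funext fun t => ?_⟩
    have := h0 t
    rw [hAB, add_comm (A' t)] at this
    exact add_left_cancel this

/-! ### Multivariate moment generating functions. -/

section MGF

variable {d : ℕ} {P Q : Measure (Fin d → ℝ)}

/-- The moment generating function of a measure on `ℝᵈ`. -/
noncomputable def mgfPi (P : Measure (Fin d → ℝ)) (t : Fin d → ℝ) : ℝ := ∫ e, Real.exp (t ⬝ᵥ e) ∂P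

lemma mgfPi_zero [IsProbabilityMeasure P] : mgfPi P 0 = 1 := by simp [mgfPi]

lemma mgfPi_pos [IsProbabilityMeasure P] {t : Fin d → ℝ}
    (h : Integrable (fun e => Real.exp (t ⬝ᵥ e)) P) : 0 < mgfPi P t := by
  exact integral_exp_pos h

/-- A finite convex function on a finite-dimensional space is continuous. -/
lemma continuous_mgfPi (h : ∀ t : Fin d → ℝ, Integrable (fun e => Real.exp (t ⬝ᵥ e)) P) :
    Continuous (mgfPi P) := by
  have hconv : ConvexOn ℝ univ (mgfPi P) := by
    refine ⟨convex_univ, fun s _ t _ x y hx hy hxy => ?_⟩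
    simp only [mgfPi, smul_eq_mul]
    rw [← integral_const_mul, ← integral_const_mul,
      ← integral_add ((h s).const_mul x) ((h t).const_mul y)]
    refine integral_mono (h _) (((h s).const_mul x).add ((h t).const_mul y)) fun e => ?_
    have := convexOn_exp.2 (mem_univ (s ⬝ᵥ e)) (mem_univ (t ⬝ᵥ e)) hx hy hxy
    simpa [add_dotProduct, smul_dotProduct] using this
  exact continuousOn_univ.1 (hconv.continuousOn isOpen_univ)

/-- A probability measure on `ℝᵈ` is determined by its moment generating function, if this is
everywhere finite. -/
lemma ext_of_mgfPi [IsProbabilityMeasure P] [IsProbabilityMeasure Q]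
    (hP : ∀ t : Fin d → ℝ, Integrable (fun e => Real.exp (t ⬝ᵥ e)) P)
    (h : ∀ t, mgfPi P t = mgfPi Q t) : P = Q := by
  -- Each functional `L` reduces the claim to one dimension, where the MGF extends analytically to
  -- the imaginary axis. Integrability under `Q` comes for free: a divergent integral would be `0`
  -- by convention, while the MGF of `P` is positive.
  refine Measure.ext_of_charFunDual (funext fun L => ?_)
  obtain ⟨τ, hτ⟩ : ∃ τ : Fin d → ℝ, ∀ v, L v = τ ⬝ᵥ v := by
    refine ⟨fun i => L (Pi.single i 1), fun v => ?_⟩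
    conv_lhs => rw [pi_eq_sum_univ' v]
    simp [dotProduct, mul_comm]
  have hmul : ∀ (s : ℝ) (v : Fin d → ℝ), s * L v = (s • τ) ⬝ᵥ v := fun s v => by
    rw [hτ, smul_dotProduct, smul_eq_mul]
  have hset : integrableExpSet (fun v => L v) P = univ := by
    refine eq_univ_of_forall fun s => ?_
    simpa only [integrableExpSet, Set.mem_ofPred_eq, hmul] using hP (s • τ)
  have hmgf : mgf (fun v => L v) P = mgf (fun v => L v) Q := by
    funext s
    simpa only [mgf, mgfPi, hmul] using h (s • τ)
  have := eqOn_complexMGF_of_mgf hmgf (x := Complex.I) (by simp [hset])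
  simpa only [complexMGF, charFunDual_apply, mul_comm Complex.I] using this

lemma integrable_exp_map_add {c t : Fin d → ℝ}
    (h : Integrable (fun e => Real.exp (t ⬝ᵥ e)) P) :
    Integrable (fun e => Real.exp (t ⬝ᵥ e)) (P.map (· + c)) := by
  rw [integrable_map_measure (by fun_prop) (by fun_prop)]
  simp only [Function.comp_def, dotProduct_add, Real.exp_add]
  exact h.mul_const _

lemma mgfPi_map_add (c t : Fin d → ℝ) :
    mgfPi (P.map (· + c)) t = Real.exp (t ⬝ᵥ c) * mgfPi P t := by
  rw [mgfPi, integral_map (by fun_prop) (by fun_prop), mgfPi, ← integral_const_mul]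
  simp only [dotProduct_add, Real.exp_add, mul_comm]

lemma integral_coord_map_add [IsProbabilityMeasure P] {i : Fin d} (hP : Integrable (fun e => e i) P)
    (hP0 : ∫ e, e i ∂P = 0) (c : Fin d → ℝ) : ∫ e, e i ∂(P.map (· + c)) = c i := by
  have hm : Measurable fun e : Fin d → ℝ => e i := measurable_pi_apply i
  rw [integral_map (by fun_prop) hm.aestronglyMeasurable]
  simp [integral_add hP (integrable_const _), hP0]

/-- Weighted and shifted centered distributions are determined by their moment generating
functions. -/
lemma weight_law_unique [IsProbabilityMeasure P] [IsProbabilityMeasure Q]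
    (hP : ∀ t : Fin d → ℝ, Integrable (fun e => Real.exp (t ⬝ᵥ e)) P)
    (hP1 : ∀ i, Integrable (fun e => e i) P) (hQ1 : ∀ i, Integrable (fun e => e i) Q)
    (hP0 : ∀ i, ∫ e, e i ∂P = 0) (hQ0 : ∀ i, ∫ e, e i ∂Q = 0) {w w' : ℝ} (hw : 0 < w)
    {c c' : Fin d → ℝ}
    (h : ∀ t, w * (Real.exp (t ⬝ᵥ c) * mgfPi P t) = w' * (Real.exp (t ⬝ᵥ c') * mgfPi Q t)) :
    w = w' ∧ P = Q := by
  have hww : w = w' := by simpa [mgfPi_zero] using h 0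
  refine ⟨hww, ?_⟩
  subst hww
  replace h := fun t => mul_left_cancel₀ hw.ne' (h t)
  have : IsProbabilityMeasure (P.map (· + c)) :=
    Measure.isProbabilityMeasure_map (by fun_prop)
  have : IsProbabilityMeasure (Q.map (· + c')) :=
    Measure.isProbabilityMeasure_map (by fun_prop)
  have hmap : P.map (· + c) = Q.map (· + c') :=
    ext_of_mgfPi (fun t => integrable_exp_map_add (hP t)) fun t => by
      rw [mgfPi_map_add, mgfPi_map_add, h]
  -- Both laws are centered, so the shifts are the means of the common shifted law.
  have hc : c = c' := funext fun i => by
    rw [← integral_coord_map_add (hP1 i) (hP0 i) c, hmap, integral_coord_map_add (hQ1 i) (hQ0 i)]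
  subst hc
  exact ext_of_mgfPi hP fun t => mul_left_cancel₀ (Real.exp_pos _).ne' (h t)

end MGF

/-! ### Moments of shifted laws and reflection of the means. -/

/-- For each `t` the sign could differ; one `t` not orthogonal to whichever of `u - v`, `u + v` is
nonzero settles it. -/
lemma sq_dotProduct_eq_imp {d : ℕ} {u v : Fin d → ℝ} (h : ∀ t, (t ⬝ᵥ u) ^ 2 = (t ⬝ᵥ v) ^ 2) :
    u = v ∨ u = -v := by
  obtain ⟨t, ht⟩ := exists_dotProduct_ne_zero (V := {u - v, u + v}) (by simp)
  rcases sq_eq_sq_iff_eq_or_eq_neg.1 (h t) with h1 | h1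
  · exact Or.inl (sub_eq_zero.1 (ht _ (by simp) (by rw [dotProduct_sub, h1, sub_self])))
  · exact Or.inr (eq_neg_of_add_eq_zero_left
      (ht _ (by simp) (by rw [dotProduct_add, h1, neg_add_cancel])))

section Moments

variable {d : ℕ} {P : Measure (Fin d → ℝ)}

lemma integrable_dotProduct_pow (hP : ∀ t : Fin d → ℝ, Integrable (fun e => Real.exp (t ⬝ᵥ e)) P)
    (t : Fin d → ℝ) (n : ℕ) : Integrable (fun e => (t ⬝ᵥ e) ^ n) P := by
  refine integrable_pow_of_integrable_exp_mul (t := 1) one_ne_zero ?_ ?_ n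
  · simpa using hP t
  · simpa using hP (-t)

lemma integral_dotProduct (hP1 : ∀ i, Integrable (fun e => e i) P)
    (hP0 : ∀ i, ∫ e, e i ∂P = 0) (t : Fin d → ℝ) : ∫ e, t ⬝ᵥ e ∂P = 0 := by
  simp only [dotProduct]
  rw [integral_finsetSum _ fun i _ => (hP1 i).const_mul _]
  simp [integral_const_mul, hP0]

lemma integrable_dotProduct_pow_map_add
    (hP : ∀ t : Fin d → ℝ, Integrable (fun e => Real.exp (t ⬝ᵥ e)) P)
    (t c : Fin d → ℝ) (n : ℕ) : Integrable (fun e => (t ⬝ᵥ e) ^ n) (P.map (· + c)) :=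
  integrable_dotProduct_pow (fun t => integrable_exp_map_add (hP t)) t n

lemma integral_dotProduct_map_add [IsProbabilityMeasure P]
    (hP : ∀ t : Fin d → ℝ, Integrable (fun e => Real.exp (t ⬝ᵥ e)) P)
    (hP1 : ∀ i, Integrable (fun e => e i) P)
    (hP0 : ∀ i, ∫ e, e i ∂P = 0) (t c : Fin d → ℝ) :
    ∫ e, t ⬝ᵥ e ∂(P.map (· + c)) = t ⬝ᵥ c := by
  rw [integral_map (by fun_prop) (by fun_prop)]
  simp only [dotProduct_add]
  have := integrable_dotProduct_pow hP t 1
  simp only [pow_one] at this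
  rw [integral_add this (integrable_const _), integral_dotProduct hP1 hP0]
  simp

lemma integral_dotProduct_sq_map_add [IsProbabilityMeasure P]
    (hP : ∀ t : Fin d → ℝ, Integrable (fun e => Real.exp (t ⬝ᵥ e)) P)
    (hP1 : ∀ i, Integrable (fun e => e i) P)
    (hP0 : ∀ i, ∫ e, e i ∂P = 0) (t c : Fin d → ℝ) :
    ∫ e, (t ⬝ᵥ e) ^ 2 ∂(P.map (· + c)) = ∫ e, (t ⬝ᵥ e) ^ 2 ∂P + (t ⬝ᵥ c) ^ 2 := by
  rw [integral_map (by fun_prop) (by fun_prop)]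
  have h1 := integrable_dotProduct_pow hP t 1
  simp only [pow_one] at h1
  have h2 := integrable_dotProduct_pow hP t 2
  have heq : ∀ e : Fin d → ℝ, (t ⬝ᵥ (e + c)) ^ 2
      = (t ⬝ᵥ e) ^ 2 + 2 * (t ⬝ᵥ c) * (t ⬝ᵥ e) + (t ⬝ᵥ c) ^ 2 := fun e => by
    rw [dotProduct_add]
    ring
  simp only [heq]
  have h3 : Integrable (fun e : Fin d → ℝ => (t ⬝ᵥ e) ^ 2 + 2 * (t ⬝ᵥ c) * (t ⬝ᵥ e)) P :=
    h2.add (h1.const_mul _)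
  rw [integral_add h3 (integrable_const _), integral_add h2 (h1.const_mul _),
    integral_const_mul, integral_dotProduct hP1 hP0]
  simp

end Moments

namespace SwitchingIV

variable {k p : ℕ} {S S' : SwitchingIV k p}

lemma ofReal_one_sub_lam_ne_zero (h : S.lam < 1) : ENNReal.ofReal (1 - S.lam) ≠ 0 := by
  simpa using h

lemma one_sub_lam_eq_zero (h : ¬ S.lam < 1) : 1 - S.lam = 0 := by
  linarith [S.lam_mem.2]

lemma integrable_mix {P Q : Measure (Fin (p + 1) → ℝ)} {f : (Fin (p + 1) → ℝ) → ℝ} :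
    Integrable f (S.mix P Q) ↔ Integrable f P ∧ (S.lam < 1 → Integrable f Q) := by
  rw [mix, integrable_add_measure,
    integrable_smul_measure (by simpa using S.lam_mem.1) ENNReal.ofReal_ne_top]
  refine and_congr_right fun _ => ?_
  by_cases h : S.lam < 1
  · rw [integrable_smul_measure (ofReal_one_sub_lam_ne_zero h) ENNReal.ofReal_ne_top]
    simp [h]
  · simp [one_sub_lam_eq_zero h, h]

lemma integral_mix {P Q : Measure (Fin (p + 1) → ℝ)} {f : (Fin (p + 1) → ℝ) → ℝ}
    (h : Integrable f (S.mix P Q)) :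
    ∫ z, f z ∂(S.mix P Q) = S.lam * ∫ z, f z ∂P + (1 - S.lam) * ∫ z, f z ∂Q := by
  rw [mix] at h ⊢
  rw [integral_add_measure h.left_of_add_measure h.right_of_add_measure, integral_smul_measure,
    integral_smul_measure, ENNReal.toReal_ofReal S.lam_mem.1.le,
    ENNReal.toReal_ofReal (sub_nonneg.2 S.lam_mem.2)]
  simp

/-- The component means in a mixture of two given error distributions are determined up to
reflection about the overall mean. -/
lemma mix_means_unique {P Q : Measure (Fin (p + 1) → ℝ)}
    [IsProbabilityMeasure P] [IsProbabilityMeasure Q] (hlam : S.lam < 1)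
    (hP : ∀ t : Fin (p + 1) → ℝ, Integrable (fun e => Real.exp (t ⬝ᵥ e)) P)
    (hQ : ∀ t : Fin (p + 1) → ℝ, Integrable (fun e => Real.exp (t ⬝ᵥ e)) Q)
    (hP1 : ∀ i, Integrable (fun e => e i) P) (hQ1 : ∀ i, Integrable (fun e => e i) Q)
    (hP0 : ∀ i, ∫ e, e i ∂P = 0) (hQ0 : ∀ i, ∫ e, e i ∂Q = 0)
    {m n m' n' : Fin (p + 1) → ℝ}
    (h : S.mix (P.map (· + m)) (Q.map (· + n)) = S.mix (P.map (· + m')) (Q.map (· + n'))) :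
    (m' = m ∧ n' = n) ∨
      (m' = (2 : ℝ) • (S.lam • m + (1 - S.lam) • n) - m ∧
        n' = (2 : ℝ) • (S.lam • m + (1 - S.lam) • n) - n) := by
  have hint : ∀ t : Fin (p + 1) → ℝ, ∀ r, ∀ m n : Fin (p + 1) → ℝ,
      Integrable (fun z => (t ⬝ᵥ z) ^ r) (S.mix (P.map (· + m)) (Q.map (· + n))) :=
    fun t r m n => integrable_mix.2 ⟨integrable_dotProduct_pow_map_add hP _ _ _,
      fun _ => integrable_dotProduct_pow_map_add hQ _ _ _⟩
  have hfst : ∀ t : Fin (p + 1) → ℝ, S.lam * (t ⬝ᵥ m) + (1 - S.lam) * (t ⬝ᵥ n)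
      = S.lam * (t ⬝ᵥ m') + (1 - S.lam) * (t ⬝ᵥ n') := by
    intro t
    have h1 := integral_mix (hint t 1 m n)
    rw [h, integral_mix (hint t 1 m' n')] at h1
    simp only [pow_one, integral_dotProduct_map_add hP hP1 hP0,
      integral_dotProduct_map_add hQ hQ1 hQ0] at h1
    exact h1.symm
  have hsnd : ∀ t : Fin (p + 1) → ℝ, S.lam * (t ⬝ᵥ m) ^ 2 + (1 - S.lam) * (t ⬝ᵥ n) ^ 2
      = S.lam * (t ⬝ᵥ m') ^ 2 + (1 - S.lam) * (t ⬝ᵥ n') ^ 2 := by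
    intro t
    have h1 := integral_mix (hint t 2 m n)
    rw [h, integral_mix (hint t 2 m' n')] at h1
    simp only [integral_dotProduct_sq_map_add hP hP1 hP0,
      integral_dotProduct_sq_map_add hQ hQ1 hQ0] at h1
    linarith
  have hpos : 0 < S.lam * (1 - S.lam) := mul_pos S.lam_mem.1 (sub_pos.2 hlam)
  -- The second moment minus the squared mean contains the between-component variance `lam * (1 -
  -- lam) * (t ⬝ᵥ (m - n)) ^ 2`; the error variances cancel.
  have hsq : ∀ t : Fin (p + 1) → ℝ, (t ⬝ᵥ (m' - n')) ^ 2 = (t ⬝ᵥ (m - n)) ^ 2 := by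
    intro t
    refine mul_left_cancel₀ hpos.ne' ?_
    simp only [dotProduct_sub]
    linear_combination (S.lam * (t ⬝ᵥ m) + (1 - S.lam) * (t ⬝ᵥ n)
      + S.lam * (t ⬝ᵥ m') + (1 - S.lam) * (t ⬝ᵥ n')) * hfst t - hsnd t
  have hbar : ∀ i, S.lam * m i + (1 - S.lam) * n i = S.lam * m' i + (1 - S.lam) * n' i :=
    fun i => by simpa using hfst (Pi.single i 1)
  -- Reversing the difference of the means while keeping the overall mean is the reflection.
  rcases sq_dotProduct_eq_imp hsq with hd | hd
  · refine Or.inl ⟨funext fun i => ?_, funext fun i => ?_⟩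
    all_goals
      have h1 := congrFun hd i
      simp only [Pi.sub_apply] at h1
    · linear_combination (1 - S.lam) * h1 - hbar i
    · linear_combination -S.lam * h1 - hbar i
  · refine Or.inr ⟨funext fun i => ?_, funext fun i => ?_⟩
    all_goals
      have h1 := congrFun hd i
      simp only [Pi.sub_apply, Pi.neg_apply, Pi.smul_apply, Pi.add_apply, smul_eq_mul] at h1 ⊢
    · linear_combination (1 - S.lam) * h1 - hbar i
    · linear_combination -S.lam * h1 - hbar i

/-! ### Component laws and the instrumental variables equation. -/

lemma measurable_snoc_outcome (S : SwitchingIV k p) (j : Fin 2) :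
    Measurable fun q : (Fin p → ℝ) × ℝ =>
      (Fin.snoc (α := fun _ => ℝ) q.1 (S.g j q.1 + q.2) : Fin (p + 1) → ℝ) := by
  refine measurable_pi_iff.2 fun i => ?_
  refine Fin.lastCases ?_ (fun i => ?_) i
  · simp only [Fin.snoc_last]
    exact ((S.measurable_g j).comp measurable_fst).add measurable_snd
  · simp only [Fin.snoc_castSucc]
    exact (measurable_pi_apply i).comp measurable_fst

instance (S : SwitchingIV k p) (j : Fin 2) (x : Fin k → ℝ) :
    IsProbabilityMeasure (S.zLaw j x) := by
  have := S.markov j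
  exact Measure.isProbabilityMeasure_map (S.measurable_snoc_outcome j).aemeasurable

instance (S : SwitchingIV k p) (j : Fin 2) (x : Fin k → ℝ) :
    IsProbabilityMeasure (S.errLaw j x) :=
  Measure.isProbabilityMeasure_map (by fun_prop)

lemma zLaw_eq_map_errLaw (S : SwitchingIV k p) (j : Fin 2) (x : Fin k → ℝ) :
    S.zLaw j x = (S.errLaw j x).map (· + S.mean j x) := by
  rw [errLaw, Measure.map_map (by fun_prop) (by fun_prop)]
  simp [Function.comp_def]

lemma wLaw_eq_map_zLaw (S : SwitchingIV k p) (j : Fin 2) (x : Fin k → ℝ) :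
    S.wLaw j x = (S.zLaw j x).map (Fin.init (α := fun _ => ℝ)) := by
  have hm : Measurable (Fin.init (α := fun _ => ℝ) : (Fin (p + 1) → ℝ) → Fin p → ℝ) :=
    measurable_pi_iff.2 fun i => measurable_pi_apply _
  rw [wLaw, zLaw, Measure.map_map hm (S.measurable_snoc_outcome j)]
  simp [Function.comp_def]

variable {X : Set (Fin k → ℝ)} {G : Submodule ℝ ((Fin p → ℝ) → ℝ)}

lemma IsModel.integrable_errLaw (hS : S.IsModel X G) (j : Fin 2) {x : Fin k → ℝ} (hx : x ∈ X)
    (i : Fin (p + 1)) : Integrable (fun e : Fin (p + 1) → ℝ => e i) (S.errLaw j x) := by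
  have hm : Measurable fun e : Fin (p + 1) → ℝ => e i := measurable_pi_apply i
  rw [errLaw, integrable_map_measure hm.aestronglyMeasurable (by fun_prop)]
  exact (hS.integrable_z j x hx i).sub (integrable_const _)

lemma IsModel.integral_errLaw (hS : S.IsModel X G) (j : Fin 2) {x : Fin k → ℝ} (hx : x ∈ X)
    (i : Fin (p + 1)) : ∫ e, e i ∂(S.errLaw j x) = 0 := by
  have hm : Measurable fun e : Fin (p + 1) → ℝ => e i := measurable_pi_apply i
  rw [errLaw, integral_map (by fun_prop) hm.aestronglyMeasurable]
  simp only [Pi.sub_apply]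
  rw [integral_sub (hS.integrable_z j x hx i) (integrable_const _)]
  simp [mean]

lemma IsModel.integrable_g (hS : S.IsModel X G) (j : Fin 2) {x : Fin k → ℝ} (hx : x ∈ X) :
    Integrable (S.g j) (S.wLaw j x) := by
  have h1 := hS.integrable_z j x hx (Fin.last p)
  rw [zLaw, integrable_map_measure (measurable_pi_apply _).aestronglyMeasurable
    (S.measurable_snoc_outcome j).aemeasurable] at h1
  rw [wLaw, integrable_map_measure (S.measurable_g j).aestronglyMeasurable
    measurable_fst.aemeasurable]
  refine (h1.sub (hS.integrable_eta j x hx)).congr (Eventually.of_forall fun q => ?_)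
  simp

lemma IsModel.ivOp_g (hS : S.IsModel X G) (j : Fin 2) {x : Fin k → ℝ} (hx : x ∈ X) :
    S.ivOp j (S.g j) x = S.mean j x (Fin.last p) := by
  have hg := hS.integrable_g j hx
  rw [wLaw, integrable_map_measure (S.measurable_g j).aestronglyMeasurable
    measurable_fst.aemeasurable] at hg
  change Integrable (fun q : (Fin p → ℝ) × ℝ => S.g j q.1) (S.law j x) at hg
  have hm : Measurable fun e : Fin (p + 1) → ℝ => e (Fin.last p) := measurable_pi_apply _
  rw [ivOp, mean, wLaw, zLaw, integral_map measurable_fst.aemeasurable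
    (S.measurable_g j).aestronglyMeasurable, integral_map
    (S.measurable_snoc_outcome j).aemeasurable hm.aestronglyMeasurable]
  simp only [Fin.snoc_last]
  rw [integral_add hg (hS.integrable_eta j x hx), hS.mean_eta j x hx, add_zero]

/-- Structural functions are determined by the component distributions. -/
lemma IsModel.eqFor_of_zLaw_eq (hS : S.IsModel X G) (hS' : S'.IsModel X G) {j j' : Fin 2}
    (hT : S.IvInvertible X G j) (h : ∀ x ∈ X, S'.zLaw j' x = S.zLaw j x) :
    S.EqFor X j (S'.g j') (S.g j) := by
  have hw : ∀ x ∈ X, S'.wLaw j' x = S.wLaw j x := fun x hx => by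
    rw [wLaw_eq_map_zLaw, wLaw_eq_map_zLaw, h x hx]
  refine hT _ ⟨hS'.g_mem j', fun x hx => hw x hx ▸ hS'.integrable_g j' hx⟩ _
    ⟨hS.g_mem j, fun x hx => hS.integrable_g j hx⟩ fun x hx => ?_
  rw [hS.ivOp_g j hx, ivOp, ← hw x hx, mean, ← h x hx]
  exact hS'.ivOp_g j' hx

end SwitchingIV

/-! ### Approach to `x₀` and identification of the components. -/

lemma mem_lineNhd_self {k : ℕ} [NeZero k] {x₀ : Fin k → ℝ} {δ : ℝ} (hδ : 0 < δ) :
    x₀ ∈ lineNhd x₀ δ := by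
  simp [lineNhd, hδ]

lemma exists_seq_lineNhd {k : ℕ} [NeZero k] (x₀ : Fin k → ℝ) {δ : ℝ} (hδ : 0 < δ) :
    ∃ u : ℕ → Fin k → ℝ, (∀ n, u n ∈ lineNhd x₀ δ ∧ u n ≠ x₀) ∧ Tendsto u atTop (𝓝 x₀) := by
  refine ⟨fun n => Function.update x₀ 0 (x₀ 0 + δ / (n + 2)), fun n => ⟨⟨?_, ?_⟩, ?_⟩, ?_⟩
  · have h2 : (0 : ℝ) < n + 2 := by positivity
    simp only [Function.update_self, add_sub_cancel_left]
    rw [abs_of_pos (by positivity), div_lt_iff₀ h2]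
    nlinarith [(Nat.cast_nonneg n : (0 : ℝ) ≤ n)]
  · intro i hi
    simp [hi]
  · intro h
    have h1 := congrFun h 0
    have h2 : 0 < δ / ((n : ℝ) + 2) := by positivity
    simp only [Function.update_self] at h1
    linarith
  · have hlim : Tendsto (fun n : ℕ => x₀ 0 + δ / ((n : ℝ) + 2)) atTop (𝓝 (x₀ 0)) := by
      have h1 : Tendsto (fun n : ℕ => (n : ℝ) + 2) atTop atTop :=
        tendsto_atTop_add_const_right _ _ tendsto_natCast_atTop_atTop
      simpa using (h1.const_div_atTop δ).const_add (x₀ 0)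
    simpa using (tendsto_const_nhds (x := x₀)).update 0 hlim

namespace SwitchingIV

variable {k p : ℕ} {S S' : SwitchingIV k p}

/-- The probabilities of the two components. -/
noncomputable def weight (S : SwitchingIV k p) : Fin 2 → ℝ := ![S.lam, 1 - S.lam]

lemma weight_nonneg (S : SwitchingIV k p) (j : Fin 2) : 0 ≤ S.weight j := by
  fin_cases j
  · exact S.lam_mem.1.le
  · exact sub_nonneg.2 S.lam_mem.2

/-- The contribution of component `j` to the moment generating function of `z`, if the error
distributions are `F` and the component means are `c`. -/
noncomputable def compMgf (S : SwitchingIV k p) (F : Fin 2 → Measure (Fin (p + 1) → ℝ))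
    (c : Fin 2 → Fin (p + 1) → ℝ) (j : Fin 2) (t : Fin (p + 1) → ℝ) : ℝ :=
  S.weight j * (Real.exp (t ⬝ᵥ c j) * mgfPi (F j) t)

lemma compMgf_eq_exp_mul (F : Fin 2 → Measure (Fin (p + 1) → ℝ))
    (c c' : Fin 2 → Fin (p + 1) → ℝ) (j : Fin 2) (t : Fin (p + 1) → ℝ) :
    S.compMgf F c' j t = Real.exp (t ⬝ᵥ (c' j - c j)) * S.compMgf F c j t := by
  rw [compMgf, compMgf, dotProduct_sub, Real.exp_sub]
  have := (Real.exp_pos (t ⬝ᵥ c j)).ne'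
  field_simp

lemma integrable_exp_errLaw {x : Fin k → ℝ} {t : Fin (p + 1) → ℝ}
    (h : Integrable (fun z => Real.exp (t ⬝ᵥ z)) (S.obsLaw x)) {j : Fin 2} (hj : S.weight j ≠ 0) :
    Integrable (fun e => Real.exp (t ⬝ᵥ e)) (S.errLaw j x) := by
  have h1 := integrable_mix.1 h
  have h2 : Integrable (fun z => Real.exp (t ⬝ᵥ z)) (S.zLaw j x) := by
    fin_cases j
    · exact h1.1
    · exact h1.2 (lt_of_le_of_ne S.lam_mem.2 fun h => hj (by simp [weight, h]))
  simpa only [errLaw, sub_eq_add_neg] using integrable_exp_map_add (c := -S.mean j x) h2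

lemma mgfPi_obsLaw {x : Fin k → ℝ} {t : Fin (p + 1) → ℝ}
    (h : Integrable (fun z => Real.exp (t ⬝ᵥ z)) (S.obsLaw x))
    {F : Fin 2 → Measure (Fin (p + 1) → ℝ)} (hF : ∀ j, S.errLaw j x = F j) :
    mgfPi (S.obsLaw x) t = S.compMgf F (fun j => S.mean j x) 0 t
      + S.compMgf F (fun j => S.mean j x) 1 t := by
  rw [mgfPi, obsLaw, integral_mix h]
  simp only [compMgf, ← hF, ← mgfPi_map_add, ← zLaw_eq_map_errLaw]
  rfl

lemma continuous_compMgf {F : Fin 2 → Measure (Fin (p + 1) → ℝ)} {j : Fin 2}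
    (hF : S.weight j ≠ 0 → ∀ t : Fin (p + 1) → ℝ, Integrable (fun e => Real.exp (t ⬝ᵥ e)) (F j))
    (c : Fin 2 → Fin (p + 1) → ℝ) : Continuous (S.compMgf F c j) := by
  by_cases hj : S.weight j = 0
  · have : S.compMgf F c j = fun _ => 0 := by
      funext t
      simp [compMgf, hj]
    rw [this]
    exact continuous_const
  · have := continuous_mgfPi (hF hj)
    unfold compMgf
    fun_prop

variable {X : Set (Fin k → ℝ)}

/-- A component of positive weight contributes at most the whole MGF, and its contribution is a
fixed positive constant times `exp (t ⬝ᵥ m_j)`. This replaces continuity of the means for the rival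
structure. -/
lemma dotProduct_mean_bddAbove {u : ℕ → Fin k → ℝ}
    {F : Fin 2 → Measure (Fin (p + 1) → ℝ)} (hF : ∀ n, ∀ j, S.errLaw j (u n) = F j)
    {t : Fin (p + 1) → ℝ}
    (hint : ∀ n, Integrable (fun z => Real.exp (t ⬝ᵥ z)) (S.obsLaw (u n)))
    (hbdd : BddAbove (range fun n => mgfPi (S.obsLaw (u n)) t)) {j : Fin 2}
    (hj : S.weight j ≠ 0) : ∃ K, ∀ n, t ⬝ᵥ S.mean j (u n) ≤ K := by
  obtain ⟨K, hK⟩ := hbdd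
  have hprob : IsProbabilityMeasure (F j) := hF 0 j ▸ inferInstance
  have hM : 0 < mgfPi (F j) t := mgfPi_pos (hF 0 j ▸ integrable_exp_errLaw (hint 0) hj)
  have hw : 0 < S.weight j := lt_of_le_of_ne (S.weight_nonneg j) hj.symm
  refine ⟨K / (S.weight j * mgfPi (F j) t), fun n => ?_⟩
  have h1 : S.compMgf F (fun j => S.mean j (u n)) j t ≤ K := by
    refine le_trans ?_ (hK ⟨n, rfl⟩)
    have hnn : ∀ i, 0 ≤ S.compMgf F (fun j => S.mean j (u n)) i t := fun i =>
      mul_nonneg (S.weight_nonneg i) (mul_nonneg (Real.exp_pos _).le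
        (integral_nonneg fun _ => (Real.exp_pos _).le))
    simp only [mgfPi_obsLaw (hint n) (hF n)]
    fin_cases j
    · exact le_add_of_nonneg_right (hnn 1)
    · exact le_add_of_nonneg_left (hnn 0)
  rw [le_div_iff₀ (mul_pos hw hM)]
  refine le_trans ?_ h1
  rw [compMgf]
  have h2 : t ⬝ᵥ S.mean j (u n) ≤ Real.exp (t ⬝ᵥ S.mean j (u n)) :=
    (by linarith [Real.add_one_le_exp (t ⬝ᵥ S.mean j (u n))])
  have := mul_le_mul_of_nonneg_right h2 (mul_pos hw hM).le
  linarith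

/-- If the component means of `S` move in different ways as `x → x₀`, then any structure with
independent errors which generates the same observable distributions has two components, and
their moment generating functions at `x₀` are, up to labeling and location, those of `S`. -/
lemma compMgf_unique (hlam : S.lam < 1) {F F' : Fin 2 → Measure (Fin (p + 1) → ℝ)}
    (hF : ∀ j, ∀ x ∈ X, S.errLaw j x = F j) (hF' : ∀ j, ∀ x ∈ X, S'.errLaw j x = F' j)
    (hobs : ∀ x ∈ X, S'.obsLaw x = S.obsLaw x)
    (hint : ∀ x ∈ X, ∀ t : Fin (p + 1) → ℝ,
      Integrable (fun z => Real.exp (t ⬝ᵥ z)) (S.obsLaw x))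
    {x₀ : Fin k → ℝ} (hx₀ : x₀ ∈ X) {u : ℕ → Fin k → ℝ} (hu : ∀ n, u n ∈ X)
    (hne : ∀ n, S.mean 0 (u n) - S.mean 0 x₀ ≠ S.mean 1 (u n) - S.mean 1 x₀)
    (hlim : ∀ j, Tendsto (fun n => S.mean j (u n)) atTop (𝓝 (S.mean j x₀))) :
    S'.lam < 1 ∧ ∃ c' : Fin 2 → Fin (p + 1) → ℝ,
      (S.compMgf F (fun j => S.mean j x₀) 0 = S'.compMgf F' c' 0 ∧
        S.compMgf F (fun j => S.mean j x₀) 1 = S'.compMgf F' c' 1) ∨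
      (S.compMgf F (fun j => S.mean j x₀) 0 = S'.compMgf F' c' 1 ∧
        S.compMgf F (fun j => S.mean j x₀) 1 = S'.compMgf F' c' 0) := by
  have hint' : ∀ x ∈ X, ∀ t : Fin (p + 1) → ℝ,
      Integrable (fun z => Real.exp (t ⬝ᵥ z)) (S'.obsLaw x) := fun x hx t => by
    rw [hobs x hx]
    exact hint x hx t
  set c : Fin 2 → Fin (p + 1) → ℝ := fun j => S.mean j x₀ with hc
  have hw : ∀ j, 0 < S.weight j := by
    intro j
    fin_cases j
    · exact S.lam_mem.1
    · exact sub_pos.2 hlam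
  have hFexp : ∀ j, ∀ t : Fin (p + 1) → ℝ, Integrable (fun e => Real.exp (t ⬝ᵥ e)) (F j) :=
    fun j t => hF j x₀ hx₀ ▸ integrable_exp_errLaw (hint x₀ hx₀ t) (hw j).ne'
  have hFexp' : ∀ j, S'.weight j ≠ 0 → ∀ t : Fin (p + 1) → ℝ,
      Integrable (fun e => Real.exp (t ⬝ᵥ e)) (F' j) :=
    fun j hj t => hF' j x₀ hx₀ ▸ integrable_exp_errLaw (hint' x₀ hx₀ t) hj
  have hpos : ∀ j t, 0 < S.compMgf F c j t := fun j t => by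
    have : IsProbabilityMeasure (F j) := hF j x₀ hx₀ ▸ inferInstance
    exact mul_pos (hw j) (mul_pos (Real.exp_pos _) (mgfPi_pos (hFexp j t)))
  have hexplim : ∀ (t : Fin (p + 1) → ℝ) {v : ℕ → Fin (p + 1) → ℝ}, Tendsto v atTop (𝓝 0) →
      Tendsto (fun n => Real.exp (t ⬝ᵥ v n)) atTop (𝓝 1) := fun t v hv => by
    have hcont : Continuous fun v : Fin (p + 1) → ℝ => Real.exp (t ⬝ᵥ v) := by fun_prop
    simpa [Function.comp_def] using (hcont.tendsto 0).comp hv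
  have hdiff : ∀ j, Tendsto (fun n => S.mean j (u n) - c j) atTop (𝓝 0) := fun j => by
    simpa [hc] using (hlim j).sub_const (c j)
  have hdecomp : ∀ n t, mgfPi (S.obsLaw (u n)) t
      = Real.exp (t ⬝ᵥ (S.mean 0 (u n) - c 0)) * S.compMgf F c 0 t
        + Real.exp (t ⬝ᵥ (S.mean 1 (u n) - c 1)) * S.compMgf F c 1 t := fun n t => by
    rw [mgfPi_obsLaw (hint _ (hu n) t) fun j => hF j _ (hu n), compMgf_eq_exp_mul F c _ 0,
      compMgf_eq_exp_mul F c _ 1]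
  have hobslim : ∀ t, Tendsto (fun n => mgfPi (S.obsLaw (u n)) t) atTop
      (𝓝 (S.compMgf F c 0 t + S.compMgf F c 1 t)) := fun t => by
    simp only [hdecomp]
    simpa using ((hexplim t (hdiff 0)).mul_const _).add ((hexplim t (hdiff 1)).mul_const _)
  -- A component of weight zero leaves no trace in the observables, so its mean need not be bounded;
  -- it is replaced by `0`.
  set m' : ℕ → Fin 2 → Fin (p + 1) → ℝ := fun n j =>
    if S'.weight j = 0 then 0 else S'.mean j (u n) with hm'
  have hbdd : ∀ j i, ∃ K, ∀ n, |m' n j i| ≤ K := by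
    intro j i
    by_cases hj : S'.weight j = 0
    · exact ⟨0, fun n => by simp [hm', hj]⟩
    have key : ∀ t : Fin (p + 1) → ℝ, ∃ K, ∀ n, t ⬝ᵥ S'.mean j (u n) ≤ K := fun t =>
      dotProduct_mean_bddAbove (fun n j => hF' j _ (hu n)) (fun n => hint' _ (hu n) t) (by
        simp only [hobs _ (hu _)]
        exact (hobslim t).bddAbove_range) hj
    obtain ⟨K, hK⟩ := key (Pi.single i 1)
    obtain ⟨K', hK'⟩ := key (-Pi.single i 1)
    refine ⟨max K K', fun n => ?_⟩
    simp only [hm', if_neg hj]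
    refine abs_le'.2 ⟨le_max_of_le_left ?_, le_max_of_le_right ?_⟩
    · simpa using hK n
    · simpa using hK' n
  choose K hK using hbdd
  -- The limit `c'` need not be the rival mean at `x₀`; it only serves as a center for the shifts.
  obtain ⟨c', -, φ, hφ, hφlim⟩ := IsCompact.tendsto_subseq
    (isCompact_univ_pi fun j => isCompact_univ_pi fun i => isCompact_Icc (a := -K j i) (b := K j i))
    (x := m') fun n j _ i _ => abs_le.1 (hK j i n)
  have hdiff' : ∀ j, Tendsto (fun n => m' (φ n) j - c' j) atTop (𝓝 0) := fun j => by
    simpa using ((tendsto_pi_nhds.1 hφlim) j).sub_const (c' j)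
  have hdecomp' : ∀ n t, mgfPi (S.obsLaw (u n)) t
      = Real.exp (t ⬝ᵥ (m' n 0 - c' 0)) * S'.compMgf F' c' 0 t
        + Real.exp (t ⬝ᵥ (m' n 1 - c' 1)) * S'.compMgf F' c' 1 t := fun n t => by
    rw [← hobs _ (hu n), mgfPi_obsLaw (hint' _ (hu n) t) fun j => hF' j _ (hu n),
      ← compMgf_eq_exp_mul, ← compMgf_eq_exp_mul]
    have : ∀ j, S'.compMgf F' (fun j => S'.mean j (u n)) j t = S'.compMgf F' (m' n) j t := by
      intro j
      by_cases hj : S'.weight j = 0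
      · simp [compMgf, hj]
      · simp [compMgf, hm', hj]
    rw [this, this]
  have hsum : ∀ t, S.compMgf F c 0 t + S.compMgf F c 1 t
      = S'.compMgf F' c' 0 t + S'.compMgf F' c' 1 t := fun t => by
    refine tendsto_nhds_unique ((hobslim t).comp hφ.tendsto_atTop) ?_
    simp only [Function.comp_def, hdecomp']
    simpa using ((hexplim t (hdiff' 0)).mul_const _).add ((hexplim t (hdiff' 1)).mul_const _)
  have hcomp := components_unique (hpos 0) (hpos 1)
    (continuous_compMgf (fun _ => hFexp 0) c) (continuous_compMgf (hFexp' 0) c')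
    (continuous_compMgf (hFexp' 1) c')
    ((hdiff 0).comp hφ.tendsto_atTop) ((hdiff 1).comp hφ.tendsto_atTop) (hdiff' 0) (hdiff' 1)
    (fun n => hne (φ n)) hsum
    (fun n t => by
      simp only [Function.comp_apply]
      rw [← hdecomp, hdecomp'])
  refine ⟨?_, c', hcomp⟩
  by_contra h
  -- With a single component the second contribution vanishes, but it would have to equal a positive
  -- one.
  have hzero : S'.compMgf F' c' 1 0 = 0 := by
    simp [compMgf, weight, one_sub_lam_eq_zero h]
  rcases hcomp with ⟨-, h1⟩ | ⟨h1, -⟩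
  · exact (hpos 1 0).ne' (by rw [h1, hzero])
  · exact (hpos 0 0).ne' (by rw [h1, hzero])

lemma ShiftAssumption.exists_seq [NeZero k] {x₀ : Fin k → ℝ} {δ : ℝ}
    (h : S.ShiftAssumption X x₀ δ) (hδ : 0 < δ) (hlam : S.lam < 1) :
    ∃ u : ℕ → Fin k → ℝ, (∀ n, u n ∈ X) ∧
      (∀ n, S.mean 0 (u n) - S.mean 0 x₀ ≠ S.mean 1 (u n) - S.mean 1 x₀) ∧
      ∀ j, Tendsto (fun n => S.mean j (u n)) atTop (𝓝 (S.mean j x₀)) := by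
  obtain ⟨u, hu, hlim⟩ := exists_seq_lineNhd x₀ hδ
  have huX : ∀ n, u n ∈ X := fun n => h.nhd_subset (hu n).1
  refine ⟨u, huX, fun n heq => ?_, fun j => ?_⟩
  · refine h.nonparallel hlam _ (hu n).1 (hu n).2 0 ?_
    have := congrFun heq 0
    simp only [Pi.sub_apply] at this
    linarith
  · exact (h.continuous j).tendsto.comp
      (tendsto_nhdsWithin_iff.2 ⟨hlim, Eventually.of_forall huX⟩)

variable {G : Submodule ℝ ((Fin p → ℝ) → ℝ)}

lemma IsModel.obsMean_eq (hS : S.IsModel X G) {x : Fin k → ℝ} (hx : x ∈ X) :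
    S.obsMean x = S.lam • S.mean 0 x + (1 - S.lam) • S.mean 1 x := by
  funext i
  rw [obsMean, obsLaw, integral_mix
    (integrable_mix.2 ⟨hS.integrable_z 0 x hx i, fun _ => hS.integrable_z 1 x hx i⟩)]
  simp [mean]

/-- Given the error distributions, non-reflection identifies the component distributions. -/
lemma IsModel.zLaw_eq (hS : S.IsModel X G) (hlam : S.lam < 1) (hrefl : S.NoReflection X)
    (hexp : ∀ j, ∀ x ∈ X, ∀ t : Fin (p + 1) → ℝ,
      Integrable (fun e => Real.exp (t ⬝ᵥ e)) (S.errLaw j x))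
    {j₀ j₁ : Fin 2} {x : Fin k → ℝ} (hx : x ∈ X) (h₀ : S'.errLaw j₀ x = S.errLaw 0 x)
    (h₁ : S'.errLaw j₁ x = S.errLaw 1 x)
    (hmix : S.obsLaw x = S.mix (S'.zLaw j₀ x) (S'.zLaw j₁ x)) :
    S'.zLaw j₀ x = S.zLaw 0 x ∧ S'.zLaw j₁ x = S.zLaw 1 x := by
  rw [zLaw_eq_map_errLaw S' j₀, zLaw_eq_map_errLaw S' j₁, h₀, h₁] at hmix ⊢
  have hmix' := hmix
  rw [obsLaw, zLaw_eq_map_errLaw S 0, zLaw_eq_map_errLaw S 1] at hmix'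
  rw [zLaw_eq_map_errLaw S 0, zLaw_eq_map_errLaw S 1]
  rcases mix_means_unique hlam (hexp 0 x hx) (hexp 1 x hx) (hS.integrable_errLaw 0 hx)
    (hS.integrable_errLaw 1 hx) (hS.integral_errLaw 0 hx) (hS.integral_errLaw 1 hx) hmix'
    with ⟨hm, hn⟩ | ⟨hm, hn⟩
  · rw [hm, hn]
    exact ⟨rfl, rfl⟩
  -- If the two means coincide they equal the overall mean, and the reflection changes nothing.
  · by_cases heq : S.mean 0 x = S.mean 1 x
    · have hm' : S'.mean j₀ x = S.mean 0 x := by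
        rw [hm, ← heq, ← add_smul, add_sub_cancel, one_smul, two_smul, add_sub_cancel_right]
      have hn' : S'.mean j₁ x = S.mean 1 x := by
        rw [hn, heq, ← add_smul, add_sub_cancel, one_smul, two_smul, add_sub_cancel_right]
      rw [hm', hn']
      exact ⟨rfl, rfl⟩
    · rw [hm, hn, ← hS.obsMean_eq hx] at hmix
      exact absurd hmix (hrefl hlam x hx heq)

end SwitchingIV

/-! ### Assembly of the identification theorem. -/

/-- Identification up to labeling. Letting `x → x₀` along the line, the shifts of the component
means tend to zero without ever agreeing, which determines the component moment generating
functions by `components_unique`; the tail and slope conditions, which make the identification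
constructive, are not needed for uniqueness. -/
theorem mainTheorem7 {k p : ℕ} [NeZero k]
    (X : Set (Fin k → ℝ)) (x₀ : Fin k → ℝ) (δ : ℝ) (hδ : 0 < δ)
    (G : Submodule ℝ ((Fin p → ℝ) → ℝ))
    (S : SwitchingIV k p) (hS : S.IsModel X G)
    (hT : ∀ j, S.IvInvertible X G j)
    (hshift : S.ShiftAssumption X x₀ δ)
    (hmgf : S.MgfAssumption x₀)
    (hslope : S.SlopeCondition x₀ δ)
    (hrefl : S.NoReflection X)
    (S' : SwitchingIV k p) (hS' : S'.IsModel X G)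
    (hindep' : S'.IndepErrors X)
    (hdeg' : S.lam = 1 → ∃ δ' > 0, S'.ShiftAssumption X x₀ δ')
    (hobs : ∀ x ∈ X, S'.obsLaw x = S.obsLaw x) :
    S.SameStructural S' X := by
  have hx₀ : x₀ ∈ X := hshift.nhd_subset (mem_lineNhd_self hδ)
  choose F hF using hshift.indep
  choose F' hF' using hindep'
  have hexp : ∀ j, ∀ x ∈ X, ∀ t : Fin (p + 1) → ℝ,
      Integrable (fun e => Real.exp (t ⬝ᵥ e)) (S.errLaw j x) := fun j x hx t => by
    rw [hF j x hx, ← hF j x₀ hx₀]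
    exact hmgf.domain j t
  have hint : ∀ x ∈ X, ∀ t : Fin (p + 1) → ℝ,
      Integrable (fun z => Real.exp (t ⬝ᵥ z)) (S.obsLaw x) := fun x hx t => by
    refine SwitchingIV.integrable_mix.2 ⟨?_, fun _ => ?_⟩
    all_goals
      rw [SwitchingIV.zLaw_eq_map_errLaw]
      exact integrable_exp_map_add (hexp _ x hx t)
  rcases S.lam_mem.2.lt_or_eq with hlam | hlam
  · obtain ⟨u, hu, hne, hlim⟩ := hshift.exists_seq hδ hlam
    obtain ⟨hlam', c', hcomp⟩ := SwitchingIV.compMgf_unique hlam hF hF' hobs hint hx₀ hu hne hlim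
    -- Error laws matched at `x₀` are matched on all of `X`, as they do not depend on `x`.
    have huniq : ∀ {j j' : Fin 2}, 0 < S.weight j →
        S.compMgf F (fun j => S.mean j x₀) j = S'.compMgf F' c' j' →
        S.weight j = S'.weight j' ∧ ∀ x ∈ X, S'.errLaw j' x = S.errLaw j x := by
      intro j j' hw h
      have h1 := weight_law_unique (P := S.errLaw j x₀) (Q := S'.errLaw j' x₀) (hexp j x₀ hx₀)
        (hS.integrable_errLaw j hx₀) (hS'.integrable_errLaw j' hx₀) (hS.integral_errLaw j hx₀)
        (hS'.integral_errLaw j' hx₀) hw (c := S.mean j x₀) (c' := c' j')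
        (w' := S'.weight j') (fun t => by
          rw [hF j x₀ hx₀, hF' j' x₀ hx₀]
          exact congrFun h t)
      refine ⟨h1.1, fun x hx => ?_⟩
      rw [hF' j' x hx, hF j x hx, ← hF' j' x₀ hx₀, ← hF j x₀ hx₀, h1.2]
    have hw0 : 0 < S.weight 0 := S.lam_mem.1
    have hw1 : 0 < S.weight 1 := sub_pos.2 hlam
    rcases hcomp with ⟨h0, h1⟩ | ⟨h0, h1⟩
    · obtain ⟨hl, he0⟩ := huniq hw0 h0
      obtain ⟨-, he1⟩ := huniq hw1 h1
      have hl : S.lam = S'.lam := hl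
      have hz : ∀ x ∈ X, S'.zLaw 0 x = S.zLaw 0 x ∧ S'.zLaw 1 x = S.zLaw 1 x := fun x hx =>
        hS.zLaw_eq hlam hrefl hexp hx (he0 x hx) (he1 x hx) (by
          rw [← hobs x hx, SwitchingIV.obsLaw, SwitchingIV.mix, SwitchingIV.mix, hl])
      exact Or.inl ⟨hl.symm, hS.eqFor_of_zLaw_eq hS' (hT 0) fun x hx => (hz x hx).1,
        fun _ => hS.eqFor_of_zLaw_eq hS' (hT 1) fun x hx => (hz x hx).2⟩
    · obtain ⟨hl, he0⟩ := huniq hw0 h0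
      obtain ⟨-, he1⟩ := huniq hw1 h1
      have hl : S.lam = 1 - S'.lam := hl
      have hl' : S'.lam = 1 - S.lam := by linarith
      have hz : ∀ x ∈ X, S'.zLaw 1 x = S.zLaw 0 x ∧ S'.zLaw 0 x = S.zLaw 1 x := fun x hx =>
        hS.zLaw_eq hlam hrefl hexp hx (he0 x hx) (he1 x hx) (by
          rw [← hobs x hx, SwitchingIV.obsLaw, SwitchingIV.mix, SwitchingIV.mix, hl',
            sub_sub_cancel]
          exact add_comm _ _)
      exact Or.inr ⟨hlam, hl', hS.eqFor_of_zLaw_eq hS' (hT 0) fun x hx => (hz x hx).1,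
        hS.eqFor_of_zLaw_eq hS' (hT 1) fun x hx => (hz x hx).2⟩
  · obtain ⟨δ', hδ', hshift'⟩ := hdeg' hlam
    have hlam' : S'.lam = 1 := by
      rcases S'.lam_mem.2.lt_or_eq with h | h
      · obtain ⟨u, hu, hne, hlim⟩ := hshift'.exists_seq hδ' h
        -- The roles are reversed: a two-component `S'` would force `S` to have two components.
        have := (SwitchingIV.compMgf_unique h hF' hF (fun x hx => (hobs x hx).symm)
          (fun x hx t => hobs x hx ▸ hint x hx t) hx₀ hu hne hlim).1
        exact absurd hlam this.ne
      · exact h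
    refine Or.inl ⟨hlam'.trans hlam.symm, hS.eqFor_of_zLaw_eq hS' (hT 0) fun x hx => ?_,
      fun h => absurd hlam h.ne⟩
    simpa [SwitchingIV.obsLaw, SwitchingIV.mix, hlam, hlam'] using hobs x hx
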